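/- All eigenvalues are those of the adjacency matrix, $\lambda_1\ge\lambda_2\ge\cdots$ listed with multiplicity; the spectral gap is $\lambda_1-\lambda_2$, and the second eigenvalue multiplicity is the number of times $\lambda_2$ occurs in the list. For a subset $S=S^{-1}$ of a group $\Gamma$, the Cayley graph $\operatorname{Cay}(\Gamma,S)$ has vertex set $\Gamma$ and edges $\{g,gs\}$ for $g\in\Gamma$, $s\in S$. (If $1\in S$ it has a loop at each vertex, which counts once in the degree and as a diagonal entry $1$ of the adjacency matrix.) Let $\Gamma$ be a finite group, let $S=S^{-1}\subseteq\Gamma$ be a symmetric subset with $|S|\ge 2$, and let $\Pi$ be the subgroup of $\Gamma$ generated by $S$. Suppose that there are exactly two double cosets, $|\Pi\backslash\Gamma/\Pi|=2$. Let $t\in\Gamma\setminus\Pi$ with $t\ne t^{-1}$. Suppose that $\operatorname{Cay}(\Pi,S)$ has spectral gap $\kappa$, and let $m\ge 4$ be an integer with $|S|^{m-1}\ge 4/\kappa$. Let $G$ be the graph obtained from $\operatorname{Cay}(\Gamma,S\cup\{t,t^{-1}\})$ by replacing each edge generated by $t$ or $t^{-1}$ by a path of $m$ edges. Then $G$ is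 connected, has $|\Gamma|m$ vertices and maximum degree $|S|+2$, and has second eigenvalue multiplicity at least $|\Gamma|/|\Pi|-1$. -/

import Mathlib

/-- An undirected graph without multiple edges on the vertex type `V`;
loops are allowed. -/
structure LoopGraph (V : Type*) where
  /-- The adjacency relation. -/
  Adj : V → V → Prop
  symm : ∀ u v, Adj u v → Adj v u

namespace LoopGraph

/-- The underlying simple graph, obtained by forgetting the loops. -/
def toSimpleGraph {V : Type*} (G : LoopGraph V) : SimpleGraph V where
  Adj u v := u ≠ v ∧ G.Adj u v
  symm := ⟨fun u v h => ⟨h.1.symm, G.symm u v h.2⟩⟩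
  loopless := ⟨fun _ h => h.1 rfl⟩

/-- Connectedness; loops play no role for it. -/
def Connected {V : Type*} (G : LoopGraph V) : Prop :=
  G.toSimpleGraph.Connected

/-- The degree of `v` is the number of `w` adjacent to `v`, i.e. the row sum of the adjacency
matrix (a loop at `v` counts once). -/
noncomputable def degree {V : Type*} (G : LoopGraph V) (v : V) : ℕ :=
  {w : V | G.Adj v w}.ncard

open Classical in
/-- The real adjacency matrix (a loop gives a diagonal entry `1`). -/
noncomputable def adjMatrix {V : Type*} (G : LoopGraph V) : Matrix V V ℝ :=
  Matrix.of fun u v => if G.Adj u v then 1 else 0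

theorem isHermitian_adjMatrix {V : Type*} (G : LoopGraph V) : G.adjMatrix.IsHermitian := by
  ext u v
  have h : G.Adj v u ↔ G.Adj u v := ⟨G.symm v u, G.symm u v⟩
  by_cases huv : G.Adj u v <;> simp [adjMatrix, h, huv]

open Classical in
/-- The eigenvalues of the adjacency matrix, with multiplicity, in descending order; the index
starts at `0`. -/
noncomputable def eigenvalues {V : Type*} [Fintype V] (G : LoopGraph V) :
    Fin (Fintype.card V) → ℝ :=
  G.isHermitian_adjMatrix.eigenvalues₀

/-- The `k`-th largest eigenvalue `λ_k`, for `1 ≤ k ≤ |V|` (and `0` for other `k`). -/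
noncomputable def eigenvalue {V : Type*} [Fintype V] (G : LoopGraph V) (k : ℕ) : ℝ :=
  if h : 1 ≤ k ∧ k ≤ Fintype.card V then G.eigenvalues ⟨k - 1, by omega⟩ else 0

/-- The spectral gap `λ₁ - λ₂` (not normalized). -/
noncomputable def spectralGap {V : Type*} [Fintype V] (G : LoopGraph V) : ℝ :=
  G.eigenvalue 1 - G.eigenvalue 2

/-- The second eigenvalue multiplicity: how often `λ₂` occurs in the list of eigenvalues. -/
noncomputable def secondEigenvalueMultiplicity {V : Type*} [Fintype V] (G : LoopGraph V) : ℕ :=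
  {i : Fin (Fintype.card V) | G.eigenvalues i = G.eigenvalue 2}.ncard

end LoopGraph

/-- The Cayley graph `Cay(Γ, S)`: the undirected edges are `{g, g * s}` for `g : Γ`, `s ∈ S`. -/
def cayleyGraph {Γ : Type*} [Group Γ] (S : Set Γ) : LoopGraph Γ where
  Adj g h := ∃ s ∈ S, h = g * s ∨ g = h * s
  symm := fun _ _ ⟨s, hs, h⟩ => ⟨s, hs, h.symm⟩

/-- The vertices of the graph in which every `t`-edge is replaced by a path of `m` edges: the
elements of `Γ`, and for each `g : Γ` the `m - 1` inner vertices of a path from `g` to `g * t`. -/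
abbrev PathVertex (Γ : Type*) (m : ℕ) : Type _ := Γ ⊕ (Γ × Fin (m - 1))

/-- The `i`-th vertex, `0 ≤ i ≤ m`, of the path of `m` edges that replaces the edge
`{g, g * t}`: it is `g` for `i = 0`, an inner vertex for `0 < i < m`, and `g * t` for `i = m`. -/
def pathVertex {Γ : Type*} [Group Γ] (t : Γ) (m : ℕ) (g : Γ) (i : ℕ) : PathVertex Γ m :=
  if i = 0 then Sum.inl g
  else if h : i - 1 < m - 1 then Sum.inr (g, ⟨i - 1, h⟩)
  else Sum.inl (g * t)

/-- The graph obtained from `Cay(Γ, S ∪ {t, t⁻¹})` by replacing each edge generated by `t` or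
`t⁻¹` by a path of `m` edges. For `t ≠ t⁻¹` these edges are the `{g, g * t}`, and they are
pairwise distinct for distinct `g : Γ`, so there is one path for each `g`. -/
def pathReplacedCayleyGraph {Γ : Type*} [Group Γ] (S : Set Γ) (t : Γ) (m : ℕ) :
    LoopGraph (PathVertex Γ m) where
  Adj u v :=
    (∃ g h : Γ, u = Sum.inl g ∧ v = Sum.inl h ∧
      (cayleyGraph (S ∪ {t, t⁻¹})).Adj g h ∧ ¬ (cayleyGraph {t, t⁻¹}).Adj g h) ∨
    ∃ g : Γ, ∃ i < m,
      (u = pathVertex t m g i ∧ v = pathVertex t m g (i + 1)) ∨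
      (u = pathVertex t m g (i + 1) ∧ v = pathVertex t m g i)
  symm := by
    rintro u v (⟨g, h, hu, hv, h1, h2⟩ | ⟨g, i, hi, h⟩)
    · exact Or.inl ⟨h, g, hv, hu, LoopGraph.symm _ _ _ h1,
        fun h3 => h2 (LoopGraph.symm _ _ _ h3)⟩
    · exact Or.inr ⟨g, i, hi, h.symm.imp And.symm And.symm⟩

/-! Write q = |S|, and let s_k be the sequence with s_0 = 0, s_1 = 1, s_{k+2} = x s_{k+1} - s_k
(`harmonicSeq`). For x ≥ 2, an eigenvector of G with eigenvalue x is determined by its restriction h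
to Γ, and eliminating the inner path vertices leaves s_m x h(g) = s_m ∑ h(gs) + 2 s_{m-1} h(g) +
h(gt) + h(gt⁻¹) (`eigenvector_inl_eq`).

The core is that no nonzero λ₂-eigenvector has all its sums over left cosets gΠ equal to zero.
Extending functions constant on Π and on its complement gives a test plane, so λ₂ exceeds every x ≥
2 with s_m(q - x) + 2 s_{m-1} - 2 > 0. At x = q + 1/q this yields λ₂ > q + 1/q, hence s_m(λ₂) >
q^(m-1) ≥ 4/κ; at x = λ₂ it yields s_m(λ₂ - q) ≥ 2 s_{m-1} - 2. If the coset sums vanish, the gap of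
Cay(Π, S) on each coset gives s_m(λ₂ - q + κ) ≤ 2 s_{m-1} + 2, so κ s_m ≤ 4, a contradiction
(`eigenvector_eq_zero_of_coset_sums_eq_zero`).

Nor can the coset sums of a nonzero λ₂-eigenvector be all equal: averaging over left translations
would give a positive λ₂-eigenvector, against Perron–Frobenius. So some λ₂-eigenvector has
nonconstant coset sums. Averaging it over suitable translates makes the sums Π-biinvariant; with two
double cosets they take one value a on Π and another value b ≠ a elsewhere. The coset sums of its
translates form the matrix (a - b)I + bJ, of rank at least |Γ/Π| - 1, which bounds the multiplicity.
-/

section Preliminaries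

open Matrix Finset

namespace LoopGraph

/-! ### Rayleigh quotients, eigenspaces and Perron–Frobenius -/

section Spectral

variable {V : Type*} [Fintype V] (G : LoopGraph V)

theorem eigenvalues_antitone : Antitone G.eigenvalues := by
  classical
  exact G.isHermitian_adjMatrix.eigenvalues₀_antitone

/-- The eigenvalues of a loop graph come with an orthonormal basis of eigenvectors. -/
theorem exists_eigenbasis : ∃ v : Fin (Fintype.card V) → V → ℝ,
    (∀ i, G.adjMatrix *ᵥ v i = G.eigenvalues i • v i) ∧
    (∀ i j, v i ⬝ᵥ v j = if i = j then 1 else 0) ∧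
    ∀ h : V → ℝ, h = ∑ i, (v i ⬝ᵥ h) • v i := by
  classical
  have hA := G.isHermitian_adjMatrix
  let b := (Matrix.isSymmetric_toEuclideanLin_iff.mpr hA).eigenvectorBasis
    finrank_euclideanSpace
  have hin : ∀ x y : EuclideanSpace ℝ V, inner ℝ x y = x.ofLp ⬝ᵥ y.ofLp := by
    intro x y
    rw [EuclideanSpace.inner_eq_star_dotProduct, dotProduct_comm]
    simp
  refine ⟨fun i => (b i).ofLp, ?_, ?_, ?_⟩
  · intro i
    have h := (Matrix.isSymmetric_toEuclideanLin_iff.mpr hA).apply_eigenvectorBasis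
      finrank_euclideanSpace i
    have h2 := congrArg WithLp.ofLp h
    simpa only [Matrix.toLpLin_apply, RCLike.ofReal_real_eq_id, id, WithLp.ofLp_smul] using! h2
  · intro i j
    rw [← hin]
    exact orthonormal_iff_ite.mp b.orthonormal i j
  · intro h
    have h1 := b.sum_repr' (WithLp.toLp 2 h)
    have h2 := congrArg WithLp.ofLp h1
    simp only [WithLp.ofLp_sum, WithLp.ofLp_smul, hin] at h2
    exact h2.symm

theorem dotProduct_adjMatrix_mulVec (u w : V → ℝ) :
    u ⬝ᵥ (G.adjMatrix *ᵥ w) = (G.adjMatrix *ᵥ u) ⬝ᵥ w := by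
  have h : G.adjMatrixᵀ = G.adjMatrix := by
    have := G.isHermitian_adjMatrix
    rwa [Matrix.IsHermitian, conjTranspose_eq_transpose_of_trivial] at this
  rw [dotProduct_mulVec, ← mulVec_transpose, h]

theorem eigenvalue_one_eq (h : 1 < Fintype.card V) :
    G.eigenvalue 1 = G.eigenvalues ⟨0, by omega⟩ := by
  rw [eigenvalue, dif_pos ⟨le_rfl, h.le⟩]

theorem eigenvalue_two_eq (h : 1 < Fintype.card V) :
    G.eigenvalue 2 = G.eigenvalues ⟨1, h⟩ := by
  rw [eigenvalue, dif_pos ⟨by omega, h⟩]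

/-- A vector orthogonal to a top eigenvector has Rayleigh quotient at most `λ₂`. -/
theorem exists_rayleigh_le (hV : 1 < Fintype.card V) :
    ∃ v : V → ℝ, v ≠ 0 ∧ G.adjMatrix *ᵥ v = G.eigenvalue 1 • v ∧
      (∀ h, v ⬝ᵥ h = 0 → h ⬝ᵥ (G.adjMatrix *ᵥ h) ≤ G.eigenvalue 2 * (h ⬝ᵥ h)) ∧
      ∀ (f : V → ℝ) (μ : ℝ), G.adjMatrix *ᵥ f = μ • f → G.eigenvalue 2 < μ →
        f = (v ⬝ᵥ f) • v := by
  obtain ⟨v, hv, ho, hs⟩ := G.exists_eigenbasis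
  have hle : ∀ i : Fin (Fintype.card V), i ≠ ⟨0, by omega⟩ →
      G.eigenvalues i ≤ G.eigenvalue 2 := by
    intro i hi
    rw [G.eigenvalue_two_eq hV]
    apply G.eigenvalues_antitone
    rw [Fin.le_def]
    have : (i : ℕ) ≠ 0 := fun h => hi (Fin.ext h)
    change 1 ≤ (i : ℕ)
    omega
  refine ⟨v ⟨0, by omega⟩, ?_, ?_, ?_, ?_⟩
  · intro h0
    have := ho ⟨0, by omega⟩ ⟨0, by omega⟩
    simp [h0] at this
  · rw [hv, G.eigenvalue_one_eq hV]
  · intro h h0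
    have h1 : h ⬝ᵥ h = ∑ i, (v i ⬝ᵥ h) ^ 2 := by
      conv_lhs => rw [hs h]
      rw [sum_dotProduct, ← hs h]
      exact sum_congr rfl fun i _ => by rw [smul_dotProduct, smul_eq_mul, sq]
    have h2 : h ⬝ᵥ (G.adjMatrix *ᵥ h) = ∑ i, G.eigenvalues i * (v i ⬝ᵥ h) ^ 2 := by
      conv_lhs => enter [1]; rw [hs h]
      rw [sum_dotProduct]
      refine sum_congr rfl fun i _ => ?_
      rw [smul_dotProduct, G.dotProduct_adjMatrix_mulVec, hv, smul_dotProduct]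
      simp only [smul_eq_mul]
      ring
    rw [h1, h2, mul_sum]
    refine sum_le_sum fun i _ => ?_
    by_cases hi : i = ⟨0, by omega⟩
    · rw [hi, h0]; simp
    · exact mul_le_mul_of_nonneg_right (hle i hi) (sq_nonneg _)
  · intro f μ hf hμ
    conv_lhs => rw [hs f]
    refine sum_eq_single _ (fun i _ hi => ?_) (by simp)
    have h1 := G.dotProduct_adjMatrix_mulVec (v i) f
    rw [hf, hv, smul_dotProduct, dotProduct_smul, smul_eq_mul, smul_eq_mul] at h1
    have h2 := hle i hi
    have h3 : v i ⬝ᵥ f = 0 := by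
      have : (μ - G.eigenvalues i) * (v i ⬝ᵥ f) = 0 := by linarith
      rcases mul_eq_zero.mp this with h | h
      · linarith
      · exact h
    rw [h3, zero_smul]

/-- If `f` is an eigenvector for an eigenvalue above `λ₂`, then vectors orthogonal to `f` have
Rayleigh quotient at most `λ₂`. -/
theorem rayleigh_le_of_dotProduct_eq_zero (hV : 1 < Fintype.card V) {f : V → ℝ} {μ : ℝ}
    (hf : G.adjMatrix *ᵥ f = μ • f) (hf0 : f ≠ 0) (hμ : G.eigenvalue 2 < μ) {h : V → ℝ}
    (hh : f ⬝ᵥ h = 0) : h ⬝ᵥ (G.adjMatrix *ᵥ h) ≤ G.eigenvalue 2 * (h ⬝ᵥ h) := by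
  obtain ⟨v, -, -, hr, hm⟩ := G.exists_rayleigh_le hV
  apply hr
  have h1 := hm f μ hf hμ
  rw [h1, smul_dotProduct, smul_eq_mul] at hh
  rcases mul_eq_zero.mp hh with h2 | h2
  · rw [h2, zero_smul] at h1
    exact absurd h1 hf0
  · exact h2

/-- A plane on which the Rayleigh quotient exceeds `x` forces `x < λ₂`. -/
theorem lt_eigenvalue_two (hV : 1 < Fintype.card V) {x : ℝ} (F : ℝ → ℝ → V → ℝ)
    (hF : ∀ v : V → ℝ, ∃ a b : ℝ, (a ≠ 0 ∨ b ≠ 0) ∧ v ⬝ᵥ F a b = 0)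
    (hq : ∀ a b, (a ≠ 0 ∨ b ≠ 0) →
      x * (F a b ⬝ᵥ F a b) < F a b ⬝ᵥ (G.adjMatrix *ᵥ F a b)) :
    x < G.eigenvalue 2 := by
  obtain ⟨v, -, -, hr, -⟩ := G.exists_rayleigh_le hV
  obtain ⟨a, b, hab, h0⟩ := hF v
  have h1 := hr _ h0
  have h2 := hq a b hab
  by_contra hx
  have h3 : 0 ≤ F a b ⬝ᵥ F a b := sum_nonneg fun i _ => mul_self_nonneg _
  nlinarith

theorem exists_eigenvector_eigenvalue_two (hV : 1 < Fintype.card V) :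
    ∃ v : V → ℝ, v ≠ 0 ∧ G.adjMatrix *ᵥ v = G.eigenvalue 2 • v := by
  obtain ⟨v, hv, ho, -⟩ := G.exists_eigenbasis
  refine ⟨v ⟨1, hV⟩, ?_, ?_⟩
  · intro h0
    have := ho ⟨1, hV⟩ ⟨1, hV⟩
    simp [h0] at this
  · rw [hv, G.eigenvalue_two_eq hV]

/-- The multiplicity of `λ₂` is at least the dimension spanned by the images of finitely many
eigenvectors under a linear map. -/
theorem exists_spanning_eigenvectors : ∃ T : Finset (V → ℝ),
    T.card ≤ G.secondEigenvalueMultiplicity ∧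
    ∀ f, G.adjMatrix *ᵥ f = G.eigenvalue 2 • f → f ∈ Submodule.span ℝ (T : Set (V → ℝ)) := by
  classical
  obtain ⟨v, hv, ho, hs⟩ := G.exists_eigenbasis
  refine ⟨(univ.filter fun i => G.eigenvalues i = G.eigenvalue 2).image v, ?_, ?_⟩
  · refine card_image_le.trans (le_of_eq ?_)
    rw [secondEigenvalueMultiplicity, ← Set.ncard_coe_finset]
    simp
  · intro f hf
    rw [hs f]
    refine Submodule.sum_mem _ fun i _ => ?_
    by_cases hi : G.eigenvalues i = G.eigenvalue 2
    · exact Submodule.smul_mem _ _ (Submodule.subset_span (by simpa using ⟨i, hi, rfl⟩))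
    · have h1 := G.dotProduct_adjMatrix_mulVec (v i) f
      rw [hf, hv, smul_dotProduct, dotProduct_smul, smul_eq_mul, smul_eq_mul] at h1
      have h3 : v i ⬝ᵥ f = 0 := by
        have : (G.eigenvalue 2 - G.eigenvalues i) * (v i ⬝ᵥ f) = 0 := by linarith
        rcases mul_eq_zero.mp this with h | h
        · exact absurd (by linarith) hi
        · exact h
      rw [h3, zero_smul]
      exact Submodule.zero_mem _

variable {G}

/-- Uniqueness in the Perron–Frobenius theorem. -/
theorem Connected.exists_eq_smul_of_pos (hG : G.Connected) {f : V → ℝ} {r : ℝ}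
    (hf : G.adjMatrix *ᵥ f = r • f) (hpos : ∀ x, 0 < f x) {h : V → ℝ} {μ : ℝ}
    (hh : G.adjMatrix *ᵥ h = μ • h) (hμ : r ≤ μ) (hex : ∃ x, 0 < h x) :
    ∃ c : ℝ, h = c • f := by
  obtain ⟨x₀, hx₀⟩ := hex
  -- With c the maximal ratio h/f, h ≤ c f with equality at u.
  obtain ⟨u, -, hu⟩ := exists_max_image univ (fun x => h x / f x) ⟨x₀, mem_univ _⟩
  set c := h u / f u with hc
  have hcpos : 0 < c := (div_pos hx₀ (hpos x₀)).trans_le (hu x₀ (mem_univ _))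
  have hle : ∀ x, h x ≤ (c • f) x := fun x => by
    have := hu x (mem_univ _)
    rw [div_le_iff₀ (hpos x)] at this
    simpa using this
  -- Equality at x but not at a neighbour would give μ h(x) < r h(x), while h(x) > 0 and r ≤ μ.
  have hstep : ∀ x y, h x = c * f x → G.Adj x y → h y = c * f y := by
    intro x y hx hxy
    by_contra hne
    have hlt : h y < c * f y := lt_of_le_of_ne (by simpa using hle y) hne
    have h1 : (G.adjMatrix *ᵥ h) x < (G.adjMatrix *ᵥ (c • f)) x := by
      refine sum_lt_sum (fun z _ => mul_le_mul_of_nonneg_left (hle z) ?_) ⟨y, mem_univ _, ?_⟩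
      · by_cases hxz : G.Adj x z <;> simp [adjMatrix, hxz]
      · simpa [adjMatrix, hxy] using hlt
    rw [mulVec_smul, hf, hh] at h1
    simp only [Pi.smul_apply, smul_eq_mul] at h1
    rw [hx] at h1
    nlinarith [mul_pos hcpos (hpos x)]
  have hwalk : ∀ x y, G.toSimpleGraph.Reachable x y → h x = c * f x → h y = c * f y := by
    rintro x y ⟨w⟩
    induction w with
    | nil => exact id
    | cons hadj _ ih => exact fun hx => ih (hstep _ _ hx hadj.2)
  refine ⟨c, funext fun x => ?_⟩
  have hu0 : h u = c * f u := by rw [hc, div_mul_cancel₀ _ (hpos u).ne']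
  exact hwalk u x (hG.preconnected u x) hu0

theorem Connected.exists_eq_smul_of_pos' (hG : G.Connected) {f : V → ℝ} {r : ℝ}
    (hf : G.adjMatrix *ᵥ f = r • f) (hpos : ∀ x, 0 < f x) {h : V → ℝ} {μ : ℝ}
    (hh : G.adjMatrix *ᵥ h = μ • h) (hμ : r ≤ μ) : ∃ c : ℝ, h = c • f := by
  by_cases hex : ∃ x, 0 < h x
  · exact hG.exists_eq_smul_of_pos hf hpos hh hμ hex
  · by_cases hex' : ∃ x, 0 < (-h) x
    · obtain ⟨c, hc⟩ := hG.exists_eq_smul_of_pos hf hpos (h := -h) (μ := μ)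
        (by rw [mulVec_neg, hh, smul_neg]) hμ hex'
      exact ⟨-c, by rw [neg_smul, ← hc, neg_neg]⟩
    · push Not at hex hex'
      refine ⟨0, funext fun x => ?_⟩
      have h1 := hex x
      have h2 := hex' x
      simp only [Pi.neg_apply] at h2
      simp only [zero_smul, Pi.zero_apply]
      linarith

/-- A positive eigenvector belongs to the largest eigenvalue, which is simple. -/
theorem Connected.eigenvalue_two_lt (hG : G.Connected) (hV : 1 < Fintype.card V) {f : V → ℝ}
    {r : ℝ} (hf : G.adjMatrix *ᵥ f = r • f) (hpos : ∀ x, 0 < f x) : G.eigenvalue 2 < r := by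
  by_contra! hle
  obtain ⟨v, hv, ho, -⟩ := G.exists_eigenbasis
  obtain ⟨c, hc⟩ := hG.exists_eq_smul_of_pos' hf hpos (hv ⟨1, hV⟩)
    (by rwa [← G.eigenvalue_two_eq hV])
  obtain ⟨d, hd⟩ := hG.exists_eq_smul_of_pos' hf hpos (hv ⟨0, by omega⟩)
    (hle.trans (by
      rw [G.eigenvalue_two_eq hV]
      exact G.eigenvalues_antitone (by simp [Fin.le_def])))
  have h11 := ho ⟨1, hV⟩ ⟨1, hV⟩
  have h00 := ho ⟨0, by omega⟩ ⟨0, by omega⟩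
  have h10 := ho ⟨1, hV⟩ ⟨0, by omega⟩
  rw [hc, hd] at h10
  rw [hc] at h11
  rw [hd] at h00
  simp only [smul_dotProduct, dotProduct_smul, smul_eq_mul, if_true, Fin.mk.injEq,
    one_ne_zero, if_false] at h11 h00 h10
  -- Two orthonormal vectors cannot both be multiples of f: this identity would read 0 = 1.
  have : (d * (c * (f ⬝ᵥ f))) ^ 2 = (c * (c * (f ⬝ᵥ f))) * (d * (d * (f ⬝ᵥ f))) := by ring
  rw [h11, h00, h10] at this
  norm_num at this

theorem Connected.eigenvalue_one_eq_of_pos (hG : G.Connected) (hV : 1 < Fintype.card V)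
    {f : V → ℝ} {r : ℝ} (hf : G.adjMatrix *ᵥ f = r • f) (hpos : ∀ x, 0 < f x) :
    G.eigenvalue 1 = r := by
  obtain ⟨v, hv0, hv, -, hm⟩ := G.exists_rayleigh_le hV
  have h1 := hm f r hf (hG.eigenvalue_two_lt hV hf hpos)
  obtain ⟨x⟩ := hG.nonempty
  have hne : v ⬝ᵥ f ≠ 0 := by
    intro h0
    rw [h0, zero_smul] at h1
    exact (hpos x).ne' (by rw [h1]; rfl)
  have h2 : G.adjMatrix *ᵥ f = G.eigenvalue 1 • f := by
    rw [h1, mulVec_smul, hv, smul_comm]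
  rw [hf] at h2
  have h3 := congrFun h2 x
  simp only [Pi.smul_apply, smul_eq_mul] at h3
  exact (mul_right_cancel₀ (hpos x).ne' h3).symm

end Spectral

end LoopGraph

namespace LoopGraph

theorem adjMatrix_mulVec_eq_sum {V : Type*} [Fintype V] (G : LoopGraph V) {v : V} {N : Finset V}
    (hN : ∀ w, G.Adj v w ↔ w ∈ N) (f : V → ℝ) : (G.adjMatrix *ᵥ f) v = ∑ w ∈ N, f w := by
  classical
  simp [mulVec, dotProduct, adjMatrix, hN]

theorem degree_eq_mulVec_one {V : Type*} [Fintype V] (G : LoopGraph V) (v : V) :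
    (G.degree v : ℝ) = (G.adjMatrix *ᵥ fun _ => 1) v := by
  classical
  rw [G.adjMatrix_mulVec_eq_sum (N := univ.filter (G.Adj v)) (by simp), degree,
    sum_const, nsmul_one, ← Set.ncard_coe_finset]
  simp

theorem reachable_of_adj {V : Type*} (G : LoopGraph V) {u v : V} (h : G.Adj u v) :
    G.toSimpleGraph.Reachable u v := by
  by_cases huv : u = v
  · rw [huv]
  · exact SimpleGraph.Adj.reachable (G := G.toSimpleGraph) ⟨huv, h⟩

end LoopGraph

/-! ### Cayley graphs and left cosets -/

section Cayley

variable {Γ : Type*} [Group Γ]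

theorem cayleyGraph_adj_iff {S : Set Γ} (hS : ∀ s ∈ S, s⁻¹ ∈ S) {g h : Γ} :
    (cayleyGraph S).Adj g h ↔ g⁻¹ * h ∈ S := by
  constructor
  · rintro ⟨s, hs, rfl | rfl⟩
    · simpa using hs
    · simpa using hS s hs
  · exact fun hs => ⟨_, hs, Or.inl (by group)⟩

theorem cayleyGraph_closure_connected {S : Set Γ} {P : Subgroup Γ}
    (hP : P = Subgroup.closure S) :
    (cayleyGraph ((fun p : P => (p : Γ)) ⁻¹' S)).Connected := by
  subst hP
  set G := cayleyGraph ((fun p : Subgroup.closure S => (p : Γ)) ⁻¹' S)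
  have key : ∀ x (hx : x ∈ Subgroup.closure S), ∀ g : Subgroup.closure S,
      G.toSimpleGraph.Reachable g (g * ⟨x, hx⟩) := by
    intro x hx
    induction hx using Subgroup.closure_induction with
    | mem x hx => exact fun g => G.reachable_of_adj ⟨⟨x, Subgroup.subset_closure hx⟩, hx, Or.inl rfl⟩
    | one => exact fun g => by rw [show (⟨1, one_mem _⟩ : Subgroup.closure S) = 1 from rfl, mul_one]
    | mul x y hx hy ihx ihy =>
      intro g
      have := (ihx g).trans (ihy _)
      rwa [mul_assoc] at this
    | inv x hx ih =>
      intro g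
      have := ih (g * ⟨x⁻¹, inv_mem hx⟩)
      rw [mul_assoc, show (⟨x⁻¹, inv_mem hx⟩ * ⟨x, hx⟩ : Subgroup.closure S) = 1 from
        Subtype.ext (inv_mul_cancel x), mul_one] at this
      exact this.symm
  refine ⟨fun g h => ?_⟩
  have := key (g⁻¹ * h : Subgroup.closure S) (g⁻¹ * h).2 g
  rwa [Subtype.coe_eta, mul_inv_cancel_left] at this

/-- Left translation by g identifies Cay(P, S) with the S-edges on the coset gP. This carries the
spectral gap from P to every left coset. -/
theorem cayleyGraph_preimage_mulVec {S : Finset Γ} (hS : ∀ s ∈ S, s⁻¹ ∈ S) {P : Subgroup Γ}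
    [Fintype P] (hSP : ∀ s ∈ S, s ∈ P) (h : Γ → ℝ) (g : Γ) (p : P) :
    ((cayleyGraph ((fun p : P => (p : Γ)) ⁻¹' (S : Set Γ))).adjMatrix *ᵥ fun q : P => h (g * q)) p =
      ∑ s ∈ S, h (g * p * s) := by
  classical
  rw [LoopGraph.adjMatrix_mulVec_eq_sum _ (N := univ.filter fun q : P => (p : Γ)⁻¹ * q ∈ S)]
  · refine sum_bij (fun q _ => (p : Γ)⁻¹ * q) (by simp) ?_ ?_ ?_
    · intro a _ b _ hab
      exact Subtype.ext (mul_left_cancel hab)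
    · intro s hs
      exact ⟨p * ⟨s, hSP s hs⟩, by simpa using hs, by simp⟩
    · intro a _
      congr 1
      group
  · intro q
    rw [cayleyGraph_adj_iff (fun s hs => by simpa using hS s hs)]
    simp

end Cayley

section DoubleCoset

variable {Γ : Type*} [Group Γ]

/-- If there are only two double cosets of `P`, then the complement of `P` is one of them. -/
theorem Subgroup.exists_eq_mul_mul_of_card_doubleCoset {P : Subgroup Γ}
    (hdc : Nat.card (DoubleCoset.Quotient (P : Set Γ) (P : Set Γ)) = 2) {t g : Γ} (ht : t ∉ P)
    (hg : g ∉ P) : ∃ a ∈ P, ∃ b ∈ P, g = a * t * b := by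
  have hone : ∀ x ∉ P, DoubleCoset.mk P P 1 ≠ DoubleCoset.mk P P x := by
    intro x hx h
    obtain ⟨a, ha, b, hb, rfl⟩ := (DoubleCoset.eq P P _ _).mp h
    exact hx (by simpa using P.mul_mem ha hb)
  have hgt : DoubleCoset.mk P P t = DoubleCoset.mk P P g := by
    obtain ⟨x, y, -, hxy⟩ := Nat.card_eq_two_iff.mp hdc
    have hm : ∀ z : DoubleCoset.Quotient (P : Set Γ) (P : Set Γ), z = x ∨ z = y := by
      intro z
      have : z ∈ ({x, y} : Set _) := hxy ▸ Set.mem_univ z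
      simpa using this
    have h1 := hone t ht
    have h2 := hone g hg
    rcases hm (DoubleCoset.mk P P 1) with h | h <;> rcases hm (DoubleCoset.mk P P t) with h' | h' <;>
      rcases hm (DoubleCoset.mk P P g) with h'' | h'' <;> simp_all
  obtain ⟨a, ha, b, hb, h⟩ := (DoubleCoset.eq P P _ _).mp hgt
  exact ⟨a, ha, b, hb, h⟩

end DoubleCoset

/-! ### Adjacency, connectedness and degrees of the path-replaced graph -/

section PathReplaced

theorem card_pathVertex {Γ : Type*} [Fintype Γ] {m : ℕ} (hm : m ≠ 0) :
    Fintype.card (PathVertex Γ m) = Fintype.card Γ * m := by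
  obtain ⟨k, rfl⟩ := Nat.exists_eq_succ_of_ne_zero hm
  simp [PathVertex]
  ring

variable {Γ : Type*} [Group Γ] {t : Γ} {m : ℕ}

theorem pathVertex_zero (t : Γ) (m : ℕ) (g : Γ) : pathVertex t m g 0 = Sum.inl g := by
  simp [pathVertex]

theorem pathVertex_self (hm : m ≠ 0) (g : Γ) : pathVertex t m g m = Sum.inl (g * t) := by
  simp [pathVertex, hm]

theorem pathVertex_succ {g : Γ} {j : ℕ} (hj : j < m - 1) :
    pathVertex t m g (j + 1) = Sum.inr (g, ⟨j, hj⟩) := by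
  simp [pathVertex, hj]

theorem pathVertex_eq_inr_iff {g g' : Γ} {i : ℕ} {j : Fin (m - 1)} :
    pathVertex t m g i = Sum.inr (g', j) ↔ g = g' ∧ i = j + 1 := by
  have := j.2
  unfold pathVertex
  split_ifs with h1 h2
  · simp [h1]
  · simp only [Sum.inr.injEq, Prod.mk.injEq, Fin.ext_iff]
    constructor <;> rintro ⟨rfl, h⟩ <;> refine ⟨rfl, ?_⟩ <;> omega
  · simp only [false_iff, not_and]
    intro _ h
    omega

theorem pathVertex_eq_inl_iff {g h : Γ} {i : ℕ} :
    pathVertex t m g i = Sum.inl h ↔ i = 0 ∧ h = g ∨ i ≠ 0 ∧ m ≤ i ∧ h = g * t := by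
  unfold pathVertex
  split_ifs with h1 h2
  · simp [h1, eq_comm]
  · simp only [false_iff]
    omega
  · simp only [Sum.inl.injEq, h1, false_and, false_or, not_false_eq_true, true_and, ne_eq]
    rw [eq_comm]
    exact ⟨fun h => ⟨by omega, h⟩, fun h => h.2⟩

variable {S : Finset Γ}

theorem pathReplacedCayleyGraph_adj_inr (g : Γ) (j : Fin (m - 1)) (w : PathVertex Γ m) :
    (pathReplacedCayleyGraph (S : Set Γ) t m).Adj (Sum.inr (g, j)) w ↔
      w = pathVertex t m g j ∨ w = pathVertex t m g (j + 2) := by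
  have hj := j.2
  constructor
  · rintro (⟨g', h', hu, -⟩ | ⟨g', i, hi, ⟨hu, hw⟩ | ⟨hu, hw⟩⟩)
    · cases hu
    · obtain ⟨rfl, rfl⟩ := pathVertex_eq_inr_iff.mp hu.symm
      exact Or.inr hw
    · obtain ⟨rfl, h⟩ := pathVertex_eq_inr_iff.mp hu.symm
      obtain rfl : i = j := by omega
      exact Or.inl hw
  · rintro (rfl | rfl)
    · exact Or.inr ⟨g, j, by omega, Or.inr ⟨(pathVertex_succ hj).symm, rfl⟩⟩
    · exact Or.inr ⟨g, j + 1, by omega, Or.inl ⟨(pathVertex_succ hj).symm, rfl⟩⟩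

/-- As t, t⁻¹ ∉ S, removing the t-edges removes no S-edge. -/
theorem pathReplacedCayleyGraph_adj_inl (hS : ∀ s ∈ S, s⁻¹ ∈ S) (ht : t ∉ S) (hm : 2 ≤ m)
    (g : Γ) (w : PathVertex Γ m) :
    (pathReplacedCayleyGraph (S : Set Γ) t m).Adj (Sum.inl g) w ↔
      (∃ s ∈ S, Sum.inl (g * s) = w) ∨
        w = pathVertex t m g 1 ∨ w = pathVertex t m (g * t⁻¹) (m - 1) := by
  have ht' : t⁻¹ ∉ S := fun h => ht (by simpa using hS _ h)
  constructor
  · rintro (⟨g', h, hu, rfl, ⟨s, hs, hs'⟩, hn⟩ | ⟨g', i, hi, ⟨hu, hw⟩ | ⟨hu, hw⟩⟩)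
    · obtain rfl := Sum.inl.inj hu
      left
      have hsS : s ∈ S := by
        rcases hs with hs | hs
        · exact hs
        · exact absurd ⟨s, hs, hs'⟩ hn
      rcases hs' with rfl | rfl
      · exact ⟨s, hsS, rfl⟩
      · exact ⟨s⁻¹, hS s hsS, by simp⟩
    · rcases pathVertex_eq_inl_iff.mp hu.symm with ⟨rfl, rfl⟩ | ⟨-, h, -⟩
      · exact Or.inr (Or.inl hw)
      · omega
    · rcases pathVertex_eq_inl_iff.mp hu.symm with ⟨h, -⟩ | ⟨-, h, rfl⟩
      · omega
      · right; right
        rw [hw, mul_inv_cancel_right]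
        congr 1
        omega
  · rintro (⟨s, hs, rfl⟩ | rfl | rfl)
    · refine Or.inl ⟨g, g * s, rfl, rfl, ⟨s, Or.inl hs, Or.inl rfl⟩, ?_⟩
      rintro ⟨u, hu, hu' | hu'⟩
      · have : s = u := mul_left_cancel hu'
        subst this
        rcases hu with rfl | rfl
        · exact ht hs
        · exact ht' hs
      · have : s = u⁻¹ := by
          have : s * u = 1 := by simpa [mul_assoc] using hu'.symm
          exact eq_inv_of_mul_eq_one_left this
        subst this
        rcases hu with rfl | rfl
        · exact ht' hs
        · exact ht (by simpa using hs)
    · exact Or.inr ⟨g, 0, by omega, Or.inl ⟨(pathVertex_zero t m g).symm, rfl⟩⟩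
    · refine Or.inr ⟨g * t⁻¹, m - 1, by omega, Or.inr ⟨?_, rfl⟩⟩
      rw [Nat.sub_add_cancel (by omega), pathVertex_self (by omega), inv_mul_cancel_right]

/-- Since t ≠ 1, the paths leaving and entering g are different, so their vertices next to g are
counted separately, even for m = 2. -/
theorem pathReplacedCayleyGraph_mulVec_inl [Fintype Γ] (hS : ∀ s ∈ S, s⁻¹ ∈ S) (ht : t ∉ S)
    (ht1 : t ≠ 1) (hm : 2 ≤ m) (f : PathVertex Γ m → ℝ) (g : Γ) :
    ((pathReplacedCayleyGraph (S : Set Γ) t m).adjMatrix *ᵥ f) (Sum.inl g) =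
      ∑ s ∈ S, f (Sum.inl (g * s)) + (f (pathVertex t m g 1) +
        f (pathVertex t m (g * t⁻¹) (m - 1))) := by
  classical
  have h1 : pathVertex t m g 1 = Sum.inr (g, ⟨0, by omega⟩) := pathVertex_succ (by omega)
  have h2 : pathVertex t m (g * t⁻¹) (m - 1) = Sum.inr (g * t⁻¹, ⟨m - 2, by omega⟩) := by
    have := pathVertex_succ (t := t) (m := m) (g := g * t⁻¹) (j := m - 2) (by omega)
    rwa [show m - 2 + 1 = m - 1 by omega] at this
  rw [LoopGraph.adjMatrix_mulVec_eq_sum _ (N := (S.image fun s => Sum.inl (g * s)) ∪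
    {pathVertex t m g 1, pathVertex t m (g * t⁻¹) (m - 1)})]
  · rw [sum_union, sum_image, sum_pair]
    · rw [h1, h2]
      simp [ht1]
    · intro a _ b _ hab
      simpa using hab
    · rw [h1, h2, Finset.disjoint_left]
      simp
  · intro w
    rw [pathReplacedCayleyGraph_adj_inl hS ht hm]
    simp only [mem_union, mem_image, mem_insert, mem_singleton]

theorem pathReplacedCayleyGraph_mulVec_path [Fintype Γ] (hm : 3 ≤ m) (f : PathVertex Γ m → ℝ)
    (g : Γ) {i : ℕ} (hi : i + 2 ≤ m) :
    ((pathReplacedCayleyGraph (S : Set Γ) t m).adjMatrix *ᵥ f) (pathVertex t m g (i + 1)) =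
      f (pathVertex t m g i) + f (pathVertex t m g (i + 2)) := by
  classical
  rw [pathVertex_succ (by omega), LoopGraph.adjMatrix_mulVec_eq_sum _
    (N := {pathVertex t m g i, pathVertex t m g (i + 2)})]
  · rw [sum_pair]
    intro h
    rcases i with _ | i
    · rw [pathVertex_zero, eq_comm, pathVertex_eq_inl_iff] at h
      omega
    · rw [pathVertex_succ (show i < m - 1 by omega), eq_comm, pathVertex_eq_inr_iff] at h
      simp at h
  · intro w
    rw [pathReplacedCayleyGraph_adj_inr]
    simp

theorem pathVertex_cases (w : PathVertex Γ m) :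
    (∃ g, w = Sum.inl g) ∨ ∃ g i, i + 2 ≤ m ∧ w = pathVertex t m g (i + 1) := by
  rcases w with g | ⟨g, j⟩
  · exact Or.inl ⟨g, rfl⟩
  · have := j.2
    exact Or.inr ⟨g, j, by omega, (pathVertex_succ j.2).symm⟩

theorem reachable_pathVertex (g : Γ) {i : ℕ} (hi : i ≤ m) :
    (pathReplacedCayleyGraph (S : Set Γ) t m).toSimpleGraph.Reachable (Sum.inl g)
      (pathVertex t m g i) := by
  induction i with
  | zero => rw [pathVertex_zero]
  | succ i ih =>
    exact (ih (by omega)).trans (LoopGraph.reachable_of_adj _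
      (Or.inr ⟨g, i, by omega, Or.inl ⟨rfl, rfl⟩⟩))

/-- S-edges join g to all of gP, and each element outside P has the form a t b with a, b ∈ P. -/
theorem pathReplacedCayleyGraph_connected (hS : ∀ s ∈ S, s⁻¹ ∈ S) (hm : 2 ≤ m)
    {P : Subgroup Γ} (hP : P = Subgroup.closure (S : Set Γ))
    (hdc : Nat.card (DoubleCoset.Quotient (P : Set Γ) (P : Set Γ)) = 2) (ht : t ∉ P) :
    (pathReplacedCayleyGraph (S : Set Γ) t m).Connected := by
  set G := pathReplacedCayleyGraph (S : Set Γ) t m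
  have hSP : ∀ s ∈ S, s ∈ P := fun s hs => hP ▸ Subgroup.subset_closure hs
  have htS : t ∉ S := fun h => ht (hSP t h)
  have hstep : ∀ x ∈ P, ∀ g : Γ, G.toSimpleGraph.Reachable (Sum.inl g) (Sum.inl (g * x)) := by
    intro x hx
    rw [hP] at hx
    induction hx using Subgroup.closure_induction with
    | mem x hx =>
      exact fun g => G.reachable_of_adj
        ((pathReplacedCayleyGraph_adj_inl hS htS hm g _).mpr (Or.inl ⟨x, hx, rfl⟩))
    | one => exact fun g => by rw [mul_one]
    | mul x y _ _ ihx ihy =>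
      intro g
      rw [← mul_assoc]
      exact (ihx g).trans (ihy _)
    | inv x _ ih =>
      intro g
      have := (ih (g * x⁻¹)).symm
      rwa [inv_mul_cancel_right] at this
  have htstep : ∀ g : Γ, G.toSimpleGraph.Reachable (Sum.inl g) (Sum.inl (g * t)) := by
    intro g
    have := reachable_pathVertex (S := S) (t := t) g (le_refl m)
    rwa [pathVertex_self (by omega)] at this
  have hall : ∀ g h : Γ, G.toSimpleGraph.Reachable (Sum.inl g) (Sum.inl h) := by
    intro g h
    by_cases hx : g⁻¹ * h ∈ P
    · simpa using hstep _ hx g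
    · obtain ⟨a, ha, b, hb, hab⟩ := P.exists_eq_mul_mul_of_card_doubleCoset hdc ht hx
      have := ((hstep a ha g).trans (htstep _)).trans (hstep b hb _)
      rwa [mul_assoc, mul_assoc, ← mul_assoc a, ← hab, mul_inv_cancel_left] at this
  have hone : ∀ w, G.toSimpleGraph.Reachable (Sum.inl 1) w := by
    intro w
    rcases pathVertex_cases (t := t) w with ⟨g, rfl⟩ | ⟨g, i, hi, rfl⟩
    · exact hall 1 g
    · exact (hall 1 g).trans (reachable_pathVertex g (by omega))
  have : Nonempty (PathVertex Γ m) := ⟨Sum.inl 1⟩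
  exact ⟨fun u v => (hone u).symm.trans (hone v)⟩

theorem isGreatest_degree_pathReplacedCayleyGraph [Fintype Γ] (hS : ∀ s ∈ S, s⁻¹ ∈ S)
    (ht : t ∉ S) (ht1 : t ≠ 1) (hm : 3 ≤ m) :
    IsGreatest (Set.range (pathReplacedCayleyGraph (S : Set Γ) t m).degree) (S.card + 2) := by
  have hinl : ∀ g : Γ, (pathReplacedCayleyGraph (S : Set Γ) t m).degree (Sum.inl g) =
      S.card + 2 := by
    intro g
    have := LoopGraph.degree_eq_mulVec_one (pathReplacedCayleyGraph (S : Set Γ) t m) (Sum.inl g)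
    rw [pathReplacedCayleyGraph_mulVec_inl hS ht ht1 (by omega)] at this
    norm_num at this
    exact_mod_cast this
  refine ⟨⟨Sum.inl 1, hinl 1⟩, ?_⟩
  rintro _ ⟨w, rfl⟩
  rcases pathVertex_cases (t := t) w with ⟨g, rfl⟩ | ⟨g, i, hi, rfl⟩
  · exact (hinl g).le
  · have := LoopGraph.degree_eq_mulVec_one (pathReplacedCayleyGraph (S : Set Γ) t m)
      (pathVertex t m g (i + 1))
    rw [pathReplacedCayleyGraph_mulVec_path hm _ g hi] at this
    norm_num at this
    have h2 : (pathReplacedCayleyGraph (S : Set Γ) t m).degree (pathVertex t m g (i + 1)) = 2 := by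
      exact_mod_cast this
    omega

end PathReplaced

/-! ### The recurrence along a path -/

section Recurrence

/-- The solution of `s (k + 2) = x * s (k + 1) - s k` with `s 0 = 0` and `s 1 = 1`
(a rescaled Chebyshev polynomial of the second kind). -/
noncomputable def harmonicSeq (x : ℝ) : ℕ → ℝ
  | 0 => 0
  | 1 => 1
  | k + 2 => x * harmonicSeq x (k + 1) - harmonicSeq x k

theorem harmonicSeq_add_two (x : ℝ) (k : ℕ) :
    harmonicSeq x (k + 2) = x * harmonicSeq x (k + 1) - harmonicSeq x k := by
  rw [harmonicSeq]

theorem harmonicSeq_zero (x : ℝ) : harmonicSeq x 0 = 0 := by rw [harmonicSeq]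

theorem harmonicSeq_one (x : ℝ) : harmonicSeq x 1 = 1 := by rw [harmonicSeq]

theorem harmonicSeq_nonneg_and_lt {x : ℝ} (hx : 2 ≤ x) (k : ℕ) :
    0 ≤ harmonicSeq x k ∧ harmonicSeq x k < harmonicSeq x (k + 1) := by
  induction k with
  | zero => rw [harmonicSeq_zero, harmonicSeq_one]; norm_num
  | succ k ih =>
    refine ⟨ih.1.trans ih.2.le, ?_⟩
    rw [harmonicSeq_add_two]
    nlinarith

theorem harmonicSeq_pos {x : ℝ} (hx : 2 ≤ x) {k : ℕ} (hk : k ≠ 0) : 0 < harmonicSeq x k := by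
  obtain ⟨j, rfl⟩ := Nat.exists_eq_succ_of_ne_zero hk
  exact (harmonicSeq_nonneg_and_lt hx j).1.trans_lt (harmonicSeq_nonneg_and_lt hx j).2

/-- If s_k < s_{k+1}/q, then s_{k+2} > (x - 1/q) s_{k+1} ≥ q s_{k+1}, so growth by the factor q
persists. -/
theorem mul_harmonicSeq_lt {q x : ℝ} (hq : 0 < q) (hx : q + 1 / q ≤ x) (k : ℕ) :
    0 ≤ harmonicSeq x k ∧ q * harmonicSeq x k < harmonicSeq x (k + 1) := by
  induction k with
  | zero => rw [harmonicSeq_zero, harmonicSeq_one]; norm_num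
  | succ k ih =>
    have h0 : 0 < harmonicSeq x (k + 1) := (mul_nonneg hq.le ih.1).trans_lt ih.2
    refine ⟨h0.le, ?_⟩
    rw [harmonicSeq_add_two]
    have h1 : harmonicSeq x k < 1 / q * harmonicSeq x (k + 1) := by
      rw [one_div, ← div_eq_inv_mul, lt_div_iff₀ hq]
      linarith [ih.2]
    nlinarith

theorem pow_le_harmonicSeq {q x : ℝ} (hq : 0 < q) (hx : q + 1 / q ≤ x) (k : ℕ) :
    q ^ k ≤ harmonicSeq x (k + 1) := by
  induction k with
  | zero => rw [harmonicSeq_one]; simp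
  | succ k ih =>
    have := (mul_harmonicSeq_lt hq hx (k + 1)).2
    rw [pow_succ']
    exact (mul_le_mul_of_nonneg_left ih hq.le).trans this.le

theorem pow_lt_harmonicSeq {q x : ℝ} (hq : 0 < q) (hx : q + 1 / q ≤ x) {m : ℕ} (hm : 2 ≤ m) :
    q ^ (m - 1) < harmonicSeq x m := by
  obtain ⟨k, rfl⟩ := Nat.exists_eq_add_of_le' hm
  have h1 := pow_le_harmonicSeq hq hx k
  have h2 := (mul_harmonicSeq_lt hq hx (k + 1)).2
  change q ^ (k + 1) < harmonicSeq x (k + 2)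
  rw [pow_succ']
  exact (mul_le_mul_of_nonneg_left h1 hq.le).trans_lt h2

/-- At x = q + 1/q the expression equals s_{m-1}(1 - 1/q²) + s_{m-2}/q - 2, and s_{m-1} ≥ q^(m-2) ≥
4 makes the first term at least 3. -/
theorem harmonicSeq_test {q : ℝ} (hq : 2 ≤ q) {m : ℕ} (hm : 4 ≤ m) :
    0 < harmonicSeq (q + 1 / q) m * (q - (q + 1 / q)) +
      2 * harmonicSeq (q + 1 / q) (m - 1) - 2 := by
  obtain ⟨k, rfl⟩ := Nat.exists_eq_add_of_le' hm
  have hq0 : 0 < q := by linarith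
  set x := q + 1 / q with hx
  change 0 < harmonicSeq x (k + 4) * (q - x) + 2 * harmonicSeq x (k + 3) - 2
  have hc := (mul_harmonicSeq_lt hq0 hx.ge (k + 2)).1
  have h3 := pow_le_harmonicSeq hq0 hx.ge (k + 2)
  have h4 : (4 : ℝ) ≤ q ^ (k + 2) := by
    calc (4 : ℝ) = 2 ^ 2 := by norm_num
      _ ≤ q ^ 2 := by gcongr
      _ ≤ q ^ (k + 2) := pow_le_pow_right₀ (by linarith) (by omega)
  have hr : harmonicSeq x (k + 4) = x * harmonicSeq x (k + 3) - harmonicSeq x (k + 2) :=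
    harmonicSeq_add_two x (k + 2)
  have hqx : q - x = -(1 / q) := by rw [hx]; ring
  have hqq : 1 / q * q = 1 := by field_simp
  have hq2 : 1 / q ≤ 1 / 2 := one_div_le_one_div_of_le (by norm_num) hq
  have hqp : 0 < 1 / q := by positivity
  have hxq : x * (1 / q) = 1 + (1 / q) ^ 2 := by rw [hx]; ring_nf; field_simp
  rw [hqx, hr]
  have key : (x * harmonicSeq x (k + 3) - harmonicSeq x (k + 2)) * -(1 / q) +
      2 * harmonicSeq x (k + 3) - 2 =
      harmonicSeq x (k + 3) * (1 - (1 / q) ^ 2) + harmonicSeq x (k + 2) * (1 / q) - 2 := by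
    linear_combination -harmonicSeq x (k + 3) * hxq
  rw [key]
  have h5 : (1 / q) ^ 2 ≤ 1 / 4 := by nlinarith
  nlinarith [mul_nonneg hc hqp.le]

theorem eq_harmonicSeq_mul {x : ℝ} {m : ℕ} {d : ℕ → ℝ}
    (hd : ∀ i, i + 2 ≤ m → x * d (i + 1) = d i + d (i + 2)) (h0 : d 0 = 0) :
    ∀ i, i + 1 ≤ m → d i = harmonicSeq x i * d 1 ∧ d (i + 1) = harmonicSeq x (i + 1) * d 1 := by
  intro i
  induction i with
  | zero => intro _; rw [h0, harmonicSeq_zero, harmonicSeq_one]; simp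
  | succ i ih =>
    intro hi
    obtain ⟨h1, h2⟩ := ih (by omega)
    refine ⟨h2, ?_⟩
    rw [harmonicSeq_add_two]
    linear_combination x * h2 - h1 - hd i hi

/-- A solution of the recurrence is determined by its boundary values. -/
theorem harmonicSeq_mul_eq {x : ℝ} (hx : 2 ≤ x) {m : ℕ} (hm : m ≠ 0) {p : ℕ → ℝ}
    (hp : ∀ i, i + 2 ≤ m → x * p (i + 1) = p i + p (i + 2)) {i : ℕ} (hi : i ≤ m) :
    harmonicSeq x m * p i = harmonicSeq x (m - i) * p 0 + harmonicSeq x i * p m := by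
  -- The defect d solves the recurrence with d 0 = 0, so d i = s_i d 1; then d m = 0 and s_m > 0
  -- force d 1 = 0.
  set d : ℕ → ℝ := fun i => harmonicSeq x m * p i -
    (harmonicSeq x (m - i) * p 0 + harmonicSeq x i * p m) with hd
  have hrec : ∀ i, i + 2 ≤ m → x * d (i + 1) = d i + d (i + 2) := by
    intro i hi
    obtain ⟨k, hk⟩ := Nat.exists_eq_add_of_le hi
    have h1 := hp i hi
    have h2 := harmonicSeq_add_two x i
    have h3 := harmonicSeq_add_two x k
    simp only [hd]
    rw [show m - (i + 1) = k + 1 by omega, show m - i = k + 2 by omega,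
      show m - (i + 2) = k by omega]
    linear_combination harmonicSeq x m * h1 + p m * h2 + p 0 * h3
  have h0 : d 0 = 0 := by simp [hd, harmonicSeq_zero]
  have hend : d m = 0 := by simp [hd, harmonicSeq_zero]
  have h1 : d 1 = 0 := by
    have := (eq_harmonicSeq_mul hrec h0 (m - 1) (by omega)).2
    rw [Nat.sub_add_cancel (by omega), hend] at this
    exact (mul_eq_zero.mp this.symm).resolve_left (harmonicSeq_pos hx hm).ne'
  have hi0 : d i = 0 := by
    rcases i with _ | i
    · exact h0
    · rw [(eq_harmonicSeq_mul hrec h0 i hi).2, h1, mul_zero]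
  simp only [hd] at hi0
  linarith

end Recurrence

/-! ### Test vectors and the lower bound for λ₂ -/

section Extension

variable {Γ : Type*} [Group Γ] {t : Γ} {m : ℕ} {x : ℝ}

/-- The extension of a multiple of `w : Γ → ℝ` to the inner path vertices that solves the
eigenvalue equation for `x` there. -/
noncomputable def harmonicExtension (x : ℝ) (t : Γ) (m : ℕ) (w : Γ → ℝ) : PathVertex Γ m → ℝ
  | Sum.inl g => harmonicSeq x m * w g
  | Sum.inr (g, j) => harmonicSeq x (m - (j + 1)) * w g + harmonicSeq x (j + 1) * w (g * t)

theorem harmonicExtension_pathVertex (hm : m ≠ 0) (w : Γ → ℝ) (g : Γ) {i : ℕ} (hi : i ≤ m) :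
    harmonicExtension x t m w (pathVertex t m g i) =
      harmonicSeq x (m - i) * w g + harmonicSeq x i * w (g * t) := by
  rcases i with _ | i
  · simp [pathVertex_zero, harmonicExtension, harmonicSeq_zero]
  · by_cases h : i < m - 1
    · rw [pathVertex_succ h, harmonicExtension]
    · obtain rfl : m = i + 1 := by omega
      rw [pathVertex_self hm, harmonicExtension]
      simp [harmonicSeq_zero]

variable [Fintype Γ] {S : Finset Γ}

theorem harmonicExtension_mulVec_path (hm : 3 ≤ m) (w : Γ → ℝ) (g : Γ) {i : ℕ}
    (hi : i + 2 ≤ m) :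
    ((pathReplacedCayleyGraph (S : Set Γ) t m).adjMatrix *ᵥ harmonicExtension x t m w)
      (pathVertex t m g (i + 1)) = x * harmonicExtension x t m w (pathVertex t m g (i + 1)) := by
  rw [pathReplacedCayleyGraph_mulVec_path hm _ g hi,
    harmonicExtension_pathVertex (by omega) w g (by omega),
    harmonicExtension_pathVertex (by omega) w g hi,
    harmonicExtension_pathVertex (by omega) w g (by omega)]
  obtain ⟨k, hk⟩ := Nat.exists_eq_add_of_le hi
  rw [show m - (i + 1) = k + 1 by omega, show m - i = k + 2 by omega,
      show m - (i + 2) = k by omega, harmonicSeq_add_two, harmonicSeq_add_two]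
  ring

theorem harmonicExtension_mulVec_inl (hS : ∀ s ∈ S, s⁻¹ ∈ S) (ht : t ∉ S) (ht1 : t ≠ 1)
    (hm : 2 ≤ m) (w : Γ → ℝ) (g : Γ) :
    ((pathReplacedCayleyGraph (S : Set Γ) t m).adjMatrix *ᵥ harmonicExtension x t m w)
      (Sum.inl g) = harmonicSeq x m * ∑ s ∈ S, w (g * s) +
        (2 * harmonicSeq x (m - 1) * w g + w (g * t) + w (g * t⁻¹)) := by
  rw [pathReplacedCayleyGraph_mulVec_inl hS ht ht1 hm,
    harmonicExtension_pathVertex (by omega) w g (by omega),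
    harmonicExtension_pathVertex (by omega) w _ (by omega),
    show m - (m - 1) = 1 by omega, harmonicSeq_one, inv_mul_cancel_right, mul_sum]
  simp only [harmonicExtension]
  ring

/-- The eigenvalue equation holds at inner path vertices, so only vertices of Γ contribute. -/
theorem harmonicExtension_quadratic (hS : ∀ s ∈ S, s⁻¹ ∈ S) (ht : t ∉ S) (ht1 : t ≠ 1)
    (hm : 3 ≤ m) (w : Γ → ℝ) :
    harmonicExtension x t m w ⬝ᵥ
      ((pathReplacedCayleyGraph (S : Set Γ) t m).adjMatrix *ᵥ harmonicExtension x t m w) -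
      x * (harmonicExtension x t m w ⬝ᵥ harmonicExtension x t m w) =
    ∑ g, harmonicSeq x m * w g * (harmonicSeq x m * ∑ s ∈ S, w (g * s) +
        (2 * harmonicSeq x (m - 1) * w g + w (g * t) + w (g * t⁻¹)) -
        x * (harmonicSeq x m * w g)) := by
  rw [dotProduct, dotProduct, mul_sum, ← sum_sub_distrib, Fintype.sum_sum_type]
  rw [show ∑ z : Γ × Fin (m - 1), _ = (0 : ℝ) from ?_, add_zero]
  · refine sum_congr rfl fun g _ => ?_
    rw [harmonicExtension_mulVec_inl hS ht ht1 (by omega)]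
    simp only [harmonicExtension]
    ring
  · refine sum_eq_zero fun z _ => ?_
    have hz : (Sum.inr z : PathVertex Γ m) = pathVertex t m z.1 (z.2 + 1) :=
      (pathVertex_succ z.2.2).symm
    have hz2 := z.2.2
    rw [hz, harmonicExtension_mulVec_path hm w _ (by omega)]
    ring

theorem neg_sum_sq_le_sum_mul (w : Γ → ℝ) (u : Γ) :
    -∑ g, w g ^ 2 ≤ ∑ g, w g * w (g * u) := by
  have h1 : ∑ g, w (g * u) ^ 2 = ∑ g, w g ^ 2 :=
    Equiv.sum_comp (Equiv.mulRight u) fun g => w g ^ 2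
  have h2 : 0 ≤ ∑ g, (w g + w (g * u)) ^ 2 := sum_nonneg fun g _ => sq_nonneg _
  have h3 : ∑ g, (w g + w (g * u)) ^ 2 =
      ∑ g, w g ^ 2 + 2 * ∑ g, w g * w (g * u) + ∑ g, w (g * u) ^ 2 := by
    rw [mul_sum, ← sum_add_distrib, ← sum_add_distrib]
    exact sum_congr rfl fun g _ => by ring
  linarith

theorem sum_mul_le_sum_sq (w : Γ → ℝ) (u : Γ) :
    ∑ g, w g * w (g * u) ≤ ∑ g, w g ^ 2 := by
  have h1 : ∑ g, w (g * u) ^ 2 = ∑ g, w g ^ 2 :=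
    Equiv.sum_comp (Equiv.mulRight u) fun g => w g ^ 2
  have h2 : 0 ≤ ∑ g, (w g - w (g * u)) ^ 2 := sum_nonneg fun g _ => sq_nonneg _
  have h3 : ∑ g, (w g - w (g * u)) ^ 2 =
      ∑ g, w g ^ 2 - 2 * ∑ g, w g * w (g * u) + ∑ g, w (g * u) ^ 2 := by
    rw [mul_sum, ← sum_sub_distrib, ← sum_add_distrib]
    exact sum_congr rfl fun g _ => by ring
  linarith

/-- For S-invariant w the S-edges contribute exactly q, and the t- and t⁻¹-terms each cost at most ∑
w². -/
theorem harmonicExtension_quadratic_ge (hS : ∀ s ∈ S, s⁻¹ ∈ S) (ht : t ∉ S) (ht1 : t ≠ 1)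
    (hm : 3 ≤ m) (hx : 2 ≤ x) {w : Γ → ℝ} (hw : ∀ g, ∀ s ∈ S, w (g * s) = w g) :
    harmonicSeq x m * (harmonicSeq x m * (S.card - x) + 2 * harmonicSeq x (m - 1) - 2) *
      ∑ g, w g ^ 2 ≤
    harmonicExtension x t m w ⬝ᵥ
      ((pathReplacedCayleyGraph (S : Set Γ) t m).adjMatrix *ᵥ harmonicExtension x t m w) -
      x * (harmonicExtension x t m w ⬝ᵥ harmonicExtension x t m w) := by
  rw [harmonicExtension_quadratic hS ht ht1 hm]
  have h1 : ∑ g, harmonicSeq x m * w g * (harmonicSeq x m * ∑ s ∈ S, w (g * s) +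
        (2 * harmonicSeq x (m - 1) * w g + w (g * t) + w (g * t⁻¹)) -
        x * (harmonicSeq x m * w g)) =
      harmonicSeq x m * ((harmonicSeq x m * (S.card - x) + 2 * harmonicSeq x (m - 1)) *
        ∑ g, w g ^ 2 + ∑ g, w g * w (g * t) + ∑ g, w g * w (g * t⁻¹)) := by
    rw [mul_sum, ← sum_add_distrib, ← sum_add_distrib, mul_sum]
    refine sum_congr rfl fun g _ => ?_
    rw [sum_congr rfl (hw g), sum_const, nsmul_eq_mul]
    ring
  rw [h1, mul_assoc]
  refine mul_le_mul_of_nonneg_left ?_ (harmonicSeq_pos hx (by omega)).le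
  linarith [neg_sum_sq_le_sum_mul w t, neg_sum_sq_le_sum_mul w t⁻¹]

theorem lt_eigenvalue_two_pathReplacedCayleyGraph (hS : ∀ s ∈ S, s⁻¹ ∈ S) {P : Subgroup Γ}
    (hSP : ∀ s ∈ S, s ∈ P) (ht : t ∉ P) (hm : 3 ≤ m) (hx : 2 ≤ x)
    (hpos : 0 < harmonicSeq x m * (S.card - x) + 2 * harmonicSeq x (m - 1) - 2) :
    x < (pathReplacedCayleyGraph (S : Set Γ) t m).eigenvalue 2 := by
  classical
  set w : ℝ → ℝ → Γ → ℝ := fun a b g => if g ∈ P then a else b with hw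
  have ht1 : t ≠ 1 := fun h => ht (h ▸ P.one_mem)
  have hV : 1 < Fintype.card (PathVertex Γ m) := by
    rw [card_pathVertex (by omega)]
    have := Fintype.card_pos (α := Γ)
    nlinarith
  refine LoopGraph.lt_eigenvalue_two _ hV (fun a b => harmonicExtension x t m (w a b)) ?_ ?_
  · intro v
    have hlin : ∀ a b, harmonicExtension x t m (w a b) =
        a • harmonicExtension x t m (w 1 0) + b • harmonicExtension x t m (w 0 1) := by
      intro a b
      have hwl : ∀ g, w a b g = a * w 1 0 g + b * w 0 1 g := by
        intro g
        by_cases hg : g ∈ P <;> simp [hw, hg]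
      funext z
      rcases z with g | ⟨g, j⟩ <;>
        simp only [harmonicExtension, Pi.add_apply, Pi.smul_apply, smul_eq_mul, hwl] <;> ring
    set α := v ⬝ᵥ harmonicExtension x t m (w 1 0) with hα
    set β := v ⬝ᵥ harmonicExtension x t m (w 0 1) with hβ
    have hdot : ∀ a b, v ⬝ᵥ harmonicExtension x t m (w a b) = a * α + b * β := by
      intro a b
      rw [hlin, dotProduct_add, dotProduct_smul, dotProduct_smul, smul_eq_mul, smul_eq_mul]
    by_cases h0 : β = 0 ∧ α = 0
    · exact ⟨1, 0, Or.inl one_ne_zero, by rw [hdot, h0.2]; ring⟩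
    -- (β, -α) spans the kernel of (a, b) ↦ aα + bβ when this functional is nonzero.
    · refine ⟨β, -α, ?_, by rw [hdot]; ring⟩
      rw [neg_ne_zero]
      tauto
  · intro a b hab
    have hinv : ∀ g, ∀ s ∈ S, w a b (g * s) = w a b g := by
      intro g s hs
      simp only [hw, P.mul_mem_cancel_right (hSP s hs)]
    have h1 := harmonicExtension_quadratic_ge hS (fun h => ht (hSP t h)) ht1 hm hx hinv
    have h2 : 0 < ∑ g, w a b g ^ 2 := by
      rcases hab with h | h
      · exact sum_pos' (fun _ _ => sq_nonneg _) ⟨1, mem_univ _, by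
          simpa [hw, P.one_mem] using pow_pos (abs_pos.mpr h) 2⟩
      · exact sum_pos' (fun _ _ => sq_nonneg _) ⟨t, mem_univ _, by
          simpa [hw, ht] using pow_pos (abs_pos.mpr h) 2⟩
    have h3 := mul_pos (mul_pos (harmonicSeq_pos hx (show m ≠ 0 by omega)) hpos) h2
    linarith

end Extension

/-! ### Reduction of eigenvectors to Γ -/

section Eigenvectors

variable {Γ : Type*} [Group Γ] [Fintype Γ] {t : Γ} {m : ℕ} {x : ℝ} {S : Finset Γ}
  {f : PathVertex Γ m → ℝ}

theorem harmonicSeq_mul_eigenvector (hm : 3 ≤ m) (hx : 2 ≤ x)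
    (hf : (pathReplacedCayleyGraph (S : Set Γ) t m).adjMatrix *ᵥ f = x • f) (g : Γ) {i : ℕ}
    (hi : i ≤ m) :
    harmonicSeq x m * f (pathVertex t m g i) =
      harmonicSeq x (m - i) * f (Sum.inl g) + harmonicSeq x i * f (Sum.inl (g * t)) := by
  have h := harmonicSeq_mul_eq hx (show m ≠ 0 by omega) (p := fun i => f (pathVertex t m g i))
    (fun i hi => by
      rw [← pathReplacedCayleyGraph_mulVec_path (S := S) hm f g hi, hf]
      rfl) hi
  simpa only [pathVertex_zero, pathVertex_self (t := t) (show m ≠ 0 by omega)] using h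

theorem eigenvector_eq_zero (hm : 3 ≤ m) (hx : 2 ≤ x)
    (hf : (pathReplacedCayleyGraph (S : Set Γ) t m).adjMatrix *ᵥ f = x • f)
    (h0 : ∀ g, f (Sum.inl g) = 0) : f = 0 := by
  funext z
  rcases pathVertex_cases (t := t) z with ⟨g, rfl⟩ | ⟨g, i, hi, rfl⟩
  · exact h0 g
  · have := harmonicSeq_mul_eigenvector hm hx hf g (show i + 1 ≤ m by omega)
    rw [h0, h0, mul_zero, mul_zero, add_zero] at this
    exact (mul_eq_zero.mp this).resolve_left (harmonicSeq_pos hx (by omega)).ne'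

theorem eigenvector_pos (hm : 3 ≤ m) (hx : 2 ≤ x)
    (hf : (pathReplacedCayleyGraph (S : Set Γ) t m).adjMatrix *ᵥ f = x • f)
    (h0 : ∀ g, 0 < f (Sum.inl g)) (z : PathVertex Γ m) : 0 < f z := by
  rcases pathVertex_cases (t := t) z with ⟨g, rfl⟩ | ⟨g, i, hi, rfl⟩
  · exact h0 g
  · have := harmonicSeq_mul_eigenvector hm hx hf g (show i + 1 ≤ m by omega)
    have h1 := mul_pos (harmonicSeq_pos hx (show m - (i + 1) ≠ 0 by omega)) (h0 g)
    have h2 := mul_pos (harmonicSeq_pos hx (show i + 1 ≠ 0 by omega)) (h0 (g * t))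
    have h3 := harmonicSeq_pos hx (show m ≠ 0 by omega)
    exact pos_of_mul_pos_right (this ▸ add_pos h1 h2) h3.le

/-- The values at the two path neighbours of g are eliminated by solving the recurrence on their
paths. -/
theorem eigenvector_inl_eq (hS : ∀ s ∈ S, s⁻¹ ∈ S) (ht : t ∉ S) (ht1 : t ≠ 1)
    (hm : 3 ≤ m) (hx : 2 ≤ x)
    (hf : (pathReplacedCayleyGraph (S : Set Γ) t m).adjMatrix *ᵥ f = x • f) (g : Γ) :
    harmonicSeq x m * (x * f (Sum.inl g)) =
      harmonicSeq x m * ∑ s ∈ S, f (Sum.inl (g * s)) + (2 * harmonicSeq x (m - 1) *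
        f (Sum.inl g) + f (Sum.inl (g * t)) + f (Sum.inl (g * t⁻¹))) := by
  have h1 := harmonicSeq_mul_eigenvector hm hx hf g (show 1 ≤ m by omega)
  have h2 := harmonicSeq_mul_eigenvector hm hx hf (g * t⁻¹) (show m - 1 ≤ m by omega)
  rw [show m - (m - 1) = 1 by omega, inv_mul_cancel_right, harmonicSeq_one] at h2
  rw [harmonicSeq_one] at h1
  have h3 := congrFun hf (Sum.inl g)
  rw [pathReplacedCayleyGraph_mulVec_inl hS ht ht1 (by omega)] at h3
  simp only [Pi.smul_apply, smul_eq_mul] at h3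
  rw [← h3]
  linear_combination h1 + h2

/-- Left translates of eigenvectors are eigenvectors. -/
theorem eigenvector_translate (hS : ∀ s ∈ S, s⁻¹ ∈ S) (ht : t ∉ S) (ht1 : t ≠ 1)
    (hm : 3 ≤ m) (hf : (pathReplacedCayleyGraph (S : Set Γ) t m).adjMatrix *ᵥ f = x • f)
    (a : Γ) :
    (pathReplacedCayleyGraph (S : Set Γ) t m).adjMatrix *ᵥ
      (fun z => f (Sum.map (a * ·) (Prod.map (a * ·) id) z)) =
      x • fun z => f (Sum.map (a * ·) (Prod.map (a * ·) id) z) := by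
  have hmap : ∀ g i, Sum.map (a * ·) (Prod.map (a * ·) id) (pathVertex t m g i) =
      pathVertex t m (a * g) i := by
    intro g i
    unfold pathVertex
    split_ifs <;> simp [mul_assoc]
  funext z
  rcases pathVertex_cases (t := t) z with ⟨g, rfl⟩ | ⟨g, i, hi, rfl⟩
  · have := congrFun hf (Sum.inl (a * g))
    rw [pathReplacedCayleyGraph_mulVec_inl hS ht ht1 (by omega)] at this ⊢
    simpa only [hmap, Sum.map_inl, mul_assoc, Pi.smul_apply] using this
  · have := congrFun hf (pathVertex t m (a * g) (i + 1))
    rw [pathReplacedCayleyGraph_mulVec_path hm _ _ hi] at this ⊢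
    simpa only [hmap, Pi.smul_apply] using this

end Eigenvectors

/-! ### The spectral gap on left cosets -/

section SpectralGap

variable {Γ : Type*} [Group Γ] {S : Finset Γ} {P : Subgroup Γ} [Fintype P]

theorem one_lt_card_subgroup (hSP : ∀ s ∈ S, s ∈ P) (hS2 : 2 ≤ S.card) : 1 < Fintype.card P := by
  have h : S.card ≤ Fintype.card P := by
    rw [← Fintype.card_coe]
    exact Fintype.card_le_of_injective (fun s : S => (⟨s, hSP s s.2⟩ : P))
      fun a b hab => Subtype.ext (congrArg (fun p : P => (p : Γ)) hab)
  omega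

theorem cayleyGraph_preimage_mulVec_one (hS : ∀ s ∈ S, s⁻¹ ∈ S) (hSP : ∀ s ∈ S, s ∈ P) :
    (cayleyGraph ((fun p : P => (p : Γ)) ⁻¹' (S : Set Γ))).adjMatrix *ᵥ (fun _ => 1) =
      (S.card : ℝ) • fun _ => 1 := by
  funext p
  have := cayleyGraph_preimage_mulVec hS hSP (fun _ => 1) 1 p
  rw [this]
  simp

/-- S generates P, so Cay(P, S) is connected and the constant vector is a positive eigenvector: λ₁ =
q is simple. Positivity of the gap also excludes the degenerate value 4 / 0 = 0 in the bound on m.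
-/
theorem cayleyGraph_closure_spectralGap (hS : ∀ s ∈ S, s⁻¹ ∈ S) (hSP : ∀ s ∈ S, s ∈ P)
    (hS2 : 2 ≤ S.card) (hP : P = Subgroup.closure (S : Set Γ)) :
    0 < (cayleyGraph ((fun p : P => (p : Γ)) ⁻¹' (S : Set Γ))).spectralGap ∧
    (cayleyGraph ((fun p : P => (p : Γ)) ⁻¹' (S : Set Γ))).eigenvalue 2 =
      S.card - (cayleyGraph ((fun p : P => (p : Γ)) ⁻¹' (S : Set Γ))).spectralGap := by
  have hV := one_lt_card_subgroup hSP hS2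
  have hG := cayleyGraph_closure_connected hP
  have h1 := cayleyGraph_preimage_mulVec_one hS hSP
  have h2 := hG.eigenvalue_two_lt hV h1 (fun _ => one_pos)
  have h3 := hG.eigenvalue_one_eq_of_pos hV h1 (fun _ => one_pos)
  rw [LoopGraph.spectralGap, h3]
  exact ⟨by linarith, by ring⟩

/-- Summing over all g instead of coset representatives counts everything |P| times and avoids
choices. -/
theorem sum_sum_subgroup_eq [Fintype Γ] (F : Γ → ℝ) :
    ∑ g, ∑ p : P, F (g * p) = Fintype.card P * ∑ g, F g := by
  have h : ∀ u, ∑ g, F (g * u) = ∑ g, F g := fun u => Equiv.sum_comp (Equiv.mulRight u) F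
  rw [sum_comm]
  simp [h]

/-- The spectral gap bounds the quadratic form of the `S`-edges on functions whose sum over every
left coset vanishes. -/
theorem sum_mul_sum_le_of_coset_sums_eq_zero [Fintype Γ] (hS : ∀ s ∈ S, s⁻¹ ∈ S)
    (hSP : ∀ s ∈ S, s ∈ P) (hS2 : 2 ≤ S.card) (hP : P = Subgroup.closure (S : Set Γ))
    {h : Γ → ℝ} (hh : ∀ g, ∑ p : P, h (g * p) = 0) :
    ∑ g, h g * ∑ s ∈ S, h (g * s) ≤
      (S.card - (cayleyGraph ((fun p : P => (p : Γ)) ⁻¹' (S : Set Γ))).spectralGap) *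
        ∑ g, h g ^ 2 := by
  set G := cayleyGraph ((fun p : P => (p : Γ)) ⁻¹' (S : Set Γ)) with hGdef
  obtain ⟨hpos, he⟩ := cayleyGraph_closure_spectralGap hS hSP hS2 hP
  have hV := one_lt_card_subgroup hSP hS2
  rw [← he]
  have hloc : ∀ g, ∑ p : P, h (g * p) * ∑ s ∈ S, h (g * p * s) ≤
      G.eigenvalue 2 * ∑ p : P, h (g * p) ^ 2 := by
    intro g
    have h1 := G.rayleigh_le_of_dotProduct_eq_zero hV (f := fun _ => 1) (μ := S.card)
      (cayleyGraph_preimage_mulVec_one hS hSP) (fun h0 => one_ne_zero (congrFun h0 1))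
      (by rw [he]; linarith) (h := fun q : P => h (g * q))
      (by simpa [dotProduct] using hh g)
    simp only [dotProduct, hGdef, cayleyGraph_preimage_mulVec hS hSP h g, ← sq] at h1
    exact h1
  have h2 := sum_le_sum fun g (_ : g ∈ univ) => hloc g
  rw [← mul_sum, sum_sum_subgroup_eq (fun g => h g * ∑ s ∈ S, h (g * s)),
    sum_sum_subgroup_eq (fun g => h g ^ 2)] at h2
  have h3 : (0 : ℝ) < Fintype.card P := by exact_mod_cast Fintype.card_pos
  refine le_of_mul_le_mul_left ?_ h3
  linarith

end SpectralGap

/-- (a - b) e_x = Φ(F x) - b·1, so the images of T together with the constant 1 span ℝ^X. -/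
theorem card_le_card_add_one_of_mem_span {X E : Type*} [Fintype X] [DecidableEq X]
    [AddCommGroup E] [Module ℝ E] (Φ : E →ₗ[ℝ] X → ℝ) (T : Finset E) {a b : ℝ} (hab : a ≠ b)
    (F : X → E) (hF : ∀ x, F x ∈ Submodule.span ℝ (T : Set E))
    (hΦ : ∀ x c, Φ (F x) c = if c = x then a else b) : Fintype.card X ≤ T.card + 1 := by
  classical
  set U : Finset (X → ℝ) := insert 1 (T.image Φ) with hU
  have hmem : ∀ x, Φ (F x) ∈ Submodule.span ℝ (U : Set (X → ℝ)) := by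
    intro x
    have h1 := Submodule.mem_map_of_mem (f := Φ) (hF x)
    rw [Submodule.map_span] at h1
    refine Submodule.span_mono ?_ h1
    simp [hU]
  have hone : (1 : X → ℝ) ∈ Submodule.span ℝ (U : Set (X → ℝ)) :=
    Submodule.subset_span (by simp [hU])
  have hsingle : ∀ x, Pi.single x (1 : ℝ) ∈ Submodule.span ℝ (U : Set (X → ℝ)) := by
    intro x
    have h1 : Pi.single x (1 : ℝ) = (a - b)⁻¹ • (Φ (F x) - b • 1) := by
      funext c
      have hne : a - b ≠ 0 := sub_ne_zero.mpr hab
      by_cases hc : c = x <;> simp [hΦ, hc, hne]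
    rw [h1]
    exact Submodule.smul_mem _ _ (Submodule.sub_mem _ (hmem x) (Submodule.smul_mem _ _ hone))
  have htop : Submodule.span ℝ (U : Set (X → ℝ)) = ⊤ := by
    rw [eq_top_iff]
    intro f _
    rw [pi_eq_sum_univ' f]
    refine Submodule.sum_mem _ fun x _ => Submodule.smul_mem _ _ ?_
    convert hsingle x using 1
  have h1 := finrank_span_finset_le_card (R := ℝ) U
  rw [Set.finrank, htop, finrank_top, Module.finrank_fintype_fun_eq_card] at h1
  exact h1.trans ((card_insert_le _ _).trans (Nat.add_le_add_right card_image_le 1))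

theorem eigenvalue_two_pathReplacedCayleyGraph_gt {Γ : Type*} [Group Γ] [Fintype Γ] {t : Γ}
    {m : ℕ} {S : Finset Γ} {P : Subgroup Γ} (hS : ∀ s ∈ S, s⁻¹ ∈ S) (hS2 : 2 ≤ S.card)
    (hSP : ∀ s ∈ S, s ∈ P) (ht : t ∉ P) (hm : 4 ≤ m) :
    (S.card : ℝ) + 1 / S.card < (pathReplacedCayleyGraph (S : Set Γ) t m).eigenvalue 2 := by
  have hq : (2 : ℝ) ≤ S.card := by exact_mod_cast hS2
  have h1 : (0 : ℝ) < 1 / S.card := by positivity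
  exact lt_eigenvalue_two_pathReplacedCayleyGraph hS hSP ht (by omega) (by linarith)
    (harmonicSeq_test hq hm)

/-! ### Coset sums and the multiplicity of λ₂ -/

section Multiplicity

variable {Γ : Type*} [Group Γ] [Fintype Γ] {t : Γ} {m : ℕ} {S : Finset Γ} {P : Subgroup Γ}
  [Fintype P]

/-- A `λ₂`-eigenvector whose sums over all left cosets vanish is zero. -/
theorem eigenvector_eq_zero_of_coset_sums_eq_zero (hS : ∀ s ∈ S, s⁻¹ ∈ S) (hS2 : 2 ≤ S.card)
    (hP : P = Subgroup.closure (S : Set Γ)) (ht : t ∉ P) (hm : 4 ≤ m)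
    (hSm : 4 / (cayleyGraph ((fun p : P => (p : Γ)) ⁻¹' (S : Set Γ))).spectralGap ≤
      (S.card : ℝ) ^ (m - 1))
    {f : PathVertex Γ m → ℝ}
    (hf : (pathReplacedCayleyGraph (S : Set Γ) t m).adjMatrix *ᵥ f =
      (pathReplacedCayleyGraph (S : Set Γ) t m).eigenvalue 2 • f)
    (hsum : ∀ g, ∑ p : P, f (Sum.inl (g * p)) = 0) : f = 0 := by
  have hSP : ∀ s ∈ S, s ∈ P := fun s hs => hP ▸ Subgroup.subset_closure hs
  set κ := (cayleyGraph ((fun p : P => (p : Γ)) ⁻¹' (S : Set Γ))).spectralGap with hκ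
  set x := (pathReplacedCayleyGraph (S : Set Γ) t m).eigenvalue 2 with hx
  have hq : (2 : ℝ) ≤ S.card := by exact_mod_cast hS2
  have hlow : (S.card : ℝ) + 1 / S.card < x := eigenvalue_two_pathReplacedCayleyGraph_gt hS hS2 hSP ht hm
  have hq1 : (0 : ℝ) < 1 / S.card := by positivity
  have hx2 : 2 ≤ x := by linarith
  have hκpos : 0 < κ := (cayleyGraph_closure_spectralGap hS hSP hS2 hP).1
  have hbig := pow_lt_harmonicSeq (by linarith) hlow.le (show 2 ≤ m by omega)
  -- Contrapositive of the test-plane bound, taken at x = λ₂ itself.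
  have hup : harmonicSeq x m * (S.card - x) + 2 * harmonicSeq x (m - 1) - 2 ≤ 0 := by
    by_contra! hc
    exact lt_irrefl x
      (lt_eigenvalue_two_pathReplacedCayleyGraph hS hSP ht (by omega) hx2 hc)
  refine eigenvector_eq_zero (by omega) hx2 hf ?_
  by_contra! hne
  obtain ⟨g₀, hg₀⟩ := hne
  set h : Γ → ℝ := fun g => f (Sum.inl g) with hh
  have hH : 0 < ∑ g, h g ^ 2 :=
    sum_pos' (fun _ _ => sq_nonneg _) ⟨g₀, mem_univ _, by positivity⟩
  have hgap := sum_mul_sum_le_of_coset_sums_eq_zero hS hSP hS2 hP (h := h) hsum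
  rw [← hκ] at hgap
  have ht1 : t ≠ 1 := fun h1 => ht (h1 ▸ P.one_mem)
  have heq : harmonicSeq x m * (x * ∑ g, h g ^ 2) =
      harmonicSeq x m * ∑ g, h g * ∑ s ∈ S, h (g * s) +
      (2 * harmonicSeq x (m - 1) * ∑ g, h g ^ 2 + ∑ g, h g * h (g * t) +
        ∑ g, h g * h (g * t⁻¹)) := by
    simp only [mul_sum (s := (univ : Finset Γ))]
    rw [← sum_add_distrib, ← sum_add_distrib, ← sum_add_distrib]
    refine sum_congr rfl fun g _ => ?_
    have := eigenvector_inl_eq hS (fun h => ht (hSP t h)) ht1 (by omega) hx2 hf g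
    simp only [hh]
    linear_combination f (Sum.inl g) * this
  have h1 := sum_mul_le_sum_sq h t
  have h2 := sum_mul_le_sum_sq h t⁻¹
  have hs := harmonicSeq_pos hx2 (show m ≠ 0 by omega)
  have h3 := mul_le_mul_of_nonneg_left hgap hs.le
  have h4 : 4 < κ * harmonicSeq x m := by
    rw [div_le_iff₀ hκpos] at hSm
    nlinarith
  -- By `hup` the bracket is at least κ s_m - 4; `heq` with the gap bound and the two translation
  -- bounds makes the product nonpositive.
  have h5 : 0 < (harmonicSeq x m * (x - S.card + κ) - 2 * harmonicSeq x (m - 1) - 2) *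
      ∑ g, h g ^ 2 := mul_pos (by linarith) hH
  linarith

/-- Some `λ₂`-eigenvector has sums over the left cosets of `P` that are not all equal. -/
theorem exists_eigenvector_coset_sums_ne (hS : ∀ s ∈ S, s⁻¹ ∈ S) (hS2 : 2 ≤ S.card)
    (hP : P = Subgroup.closure (S : Set Γ)) (ht : t ∉ P) (hm : 4 ≤ m)
    (hdc : Nat.card (DoubleCoset.Quotient (P : Set Γ) (P : Set Γ)) = 2)
    (hSm : 4 / (cayleyGraph ((fun p : P => (p : Γ)) ⁻¹' (S : Set Γ))).spectralGap ≤
      (S.card : ℝ) ^ (m - 1)) :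
    ∃ f : PathVertex Γ m → ℝ, (pathReplacedCayleyGraph (S : Set Γ) t m).adjMatrix *ᵥ f =
      (pathReplacedCayleyGraph (S : Set Γ) t m).eigenvalue 2 • f ∧
      ∃ g₀, ∑ g, ∑ p : P, f (Sum.inl (g * p)) ≠
        Fintype.card Γ * ∑ p : P, f (Sum.inl (g₀ * p)) := by
  have hSP : ∀ s ∈ S, s ∈ P := fun s hs => hP ▸ Subgroup.subset_closure hs
  have htS : t ∉ S := fun h => ht (hSP t h)
  have ht1 : t ≠ 1 := fun h1 => ht (h1 ▸ P.one_mem)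
  have hV : 1 < Fintype.card (PathVertex Γ m) := by
    rw [card_pathVertex (by omega)]
    have := Fintype.card_pos (α := Γ)
    nlinarith
  set G := pathReplacedCayleyGraph (S : Set Γ) t m with hG
  have hlow := eigenvalue_two_pathReplacedCayleyGraph_gt hS hS2 hSP ht hm
  have hq : (2 : ℝ) ≤ S.card := by exact_mod_cast hS2
  have hq1 : (0 : ℝ) < 1 / S.card := by positivity
  obtain ⟨f, hf0, hf⟩ := G.exists_eigenvector_eigenvalue_two hV
  refine ⟨f, hf, ?_⟩
  by_contra! hconst
  rw [sum_sum_subgroup_eq (fun g => f (Sum.inl g))] at hconst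
  have hc : (0 : ℝ) < Fintype.card Γ := by exact_mod_cast Fintype.card_pos
  -- All coset sums are equal, so a zero total would make each of them zero.
  have hne : ∑ g, f (Sum.inl g) ≠ 0 := by
    intro h0
    refine hf0 (eigenvector_eq_zero_of_coset_sums_eq_zero hS hS2 hP ht hm hSm hf fun g => ?_)
    have := hconst g
    rw [h0, mul_zero] at this
    exact (mul_eq_zero.mp this.symm).resolve_left hc.ne'
  set c := ∑ g, f (Sum.inl g) with hcdef
  -- The normalized sum of all left translates equals 1 on Γ, hence is positive everywhere.
  set F : PathVertex Γ m → ℝ :=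
    c⁻¹ • ∑ a : Γ, fun z => f (Sum.map (a * ·) (Prod.map (a * ·) id) z) with hF
  have hFeig : G.adjMatrix *ᵥ F = G.eigenvalue 2 • F := by
    rw [hF, mulVec_smul, mulVec_sum, smul_comm (G.eigenvalue 2), smul_sum (r := G.eigenvalue 2)]
    congr 1
    exact sum_congr rfl fun a _ => eigenvector_translate hS htS ht1 (by omega) hf a
  have hFpos : ∀ g, 0 < F (Sum.inl g) := by
    intro g
    have : F (Sum.inl g) = 1 := by
      simp only [hF, Pi.smul_apply, Finset.sum_apply, Sum.map_inl, smul_eq_mul]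
      have h1 : ∑ a, f (Sum.inl (a * g)) = c :=
        Equiv.sum_comp (Equiv.mulRight g) fun a => f (Sum.inl a)
      rw [h1, inv_mul_cancel₀ hne]
    rw [this]
    exact one_pos
  exact lt_irrefl _ ((pathReplacedCayleyGraph_connected hS (by omega) hP hdc ht).eigenvalue_two_lt
    hV hFeig (eigenvector_pos (by omega) (by linarith) hFeig hFpos))

theorem card_quotient_le_secondEigenvalueMultiplicity_add_one (hS : ∀ s ∈ S, s⁻¹ ∈ S)
    (hS2 : 2 ≤ S.card) (hP : P = Subgroup.closure (S : Set Γ)) (ht : t ∉ P) (hm : 4 ≤ m)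
    (hdc : Nat.card (DoubleCoset.Quotient (P : Set Γ) (P : Set Γ)) = 2)
    (hSm : 4 / (cayleyGraph ((fun p : P => (p : Γ)) ⁻¹' (S : Set Γ))).spectralGap ≤
      (S.card : ℝ) ^ (m - 1)) :
    Nat.card (Γ ⧸ P) ≤
      (pathReplacedCayleyGraph (S : Set Γ) t m).secondEigenvalueMultiplicity + 1 := by
  classical
  have hSP : ∀ s ∈ S, s ∈ P := fun s hs => hP ▸ Subgroup.subset_closure hs
  have htS : t ∉ S := fun h => ht (hSP t h)
  have ht1 : t ≠ 1 := fun h1 => ht (h1 ▸ P.one_mem)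
  set G := pathReplacedCayleyGraph (S : Set Γ) t m with hG
  obtain ⟨f, hf, g₀, hg₀⟩ := exists_eigenvector_coset_sums_ne hS hS2 hP ht hm hdc hSm
  obtain ⟨T, hT, hspan⟩ := G.exists_spanning_eigenvectors
  set φ : Γ → ℝ := fun g => ∑ p : P, f (Sum.inl (g * p)) with hφ
  have hφr : ∀ g, ∀ p ∈ P, φ (g * p) = φ g := by
    intro g p hp
    have := Equiv.sum_comp (Equiv.mulLeft (⟨p, hp⟩ : P)) fun q : P => f (Sum.inl (g * q))
    simpa [hφ, mul_assoc] using this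
  -- Translating by g₀ moves the exceptional coset to P; summing over a ∈ P makes the coset sums
  -- left P-invariant as well.
  set F : PathVertex Γ m → ℝ :=
    ∑ a : P, fun z => f (Sum.map (g₀ * a * ·) (Prod.map (g₀ * a * ·) id) z) with hF
  have hFeig : G.adjMatrix *ᵥ F = G.eigenvalue 2 • F := by
    rw [hF, mulVec_sum, smul_sum]
    exact sum_congr rfl fun a _ => eigenvector_translate hS htS ht1 (by omega) hf _
  set ψ : Γ → ℝ := fun g => ∑ p : P, F (Sum.inl (g * p)) with hψ
  have hψφ : ∀ g, ψ g = ∑ a : P, φ (g₀ * a * g) := by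
    intro g
    simp only [hψ, hF, hφ, Finset.sum_apply, Sum.map_inl]
    rw [sum_comm]
    simp only [mul_assoc]
  have hψr : ∀ g, ∀ p ∈ P, ψ (g * p) = ψ g := by
    intro g p hp
    rw [hψφ, hψφ]
    refine sum_congr rfl fun a _ => ?_
    rw [← mul_assoc, hφr _ p hp]
  have hψl : ∀ g, ∀ p ∈ P, ψ (p * g) = ψ g := by
    intro g p hp
    rw [hψφ, hψφ]
    have := Equiv.sum_comp (Equiv.mulRight (⟨p, hp⟩ : P)) fun q : P => φ (g₀ * q * g)
    simpa [mul_assoc] using this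
  have hψval : ∀ g, ψ g = if g ∈ P then ψ 1 else ψ t := by
    intro g
    split_ifs with hg
    · simpa using hψl 1 g hg
    · obtain ⟨a, ha, b, hb, rfl⟩ := P.exists_eq_mul_mul_of_card_doubleCoset hdc ht hg
      rw [hψr _ b hb, hψl _ a ha]
  have hcP : (0 : ℝ) < Fintype.card P := by exact_mod_cast Fintype.card_pos
  -- If ψ were constant, ψ 1 = |P| φ g₀ and ∑ ψ = |P| ∑ φ would make φ g₀ the average of φ, against
  -- the choice of g₀.
  have hab : ψ 1 ≠ ψ t := by
    intro hab
    have hconst : ∀ g, ψ g = ψ 1 := fun g => by rw [hψval g, ← hab, ite_self]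
    have h1 : ψ 1 = Fintype.card P * φ g₀ := by
      rw [hψφ]
      simp [hφr _ _ (SetLike.coe_mem _)]
    have h2 : ∑ g, ψ g = Fintype.card P * ∑ g, φ g := by
      simp only [hψφ]
      have h3 : ∀ u, ∑ g, φ (u * g) = ∑ g, φ g := fun u => Equiv.sum_comp (Equiv.mulLeft u) φ
      rw [sum_comm]
      simp [h3]
    rw [sum_congr rfl fun g _ => hconst g, h1, sum_const, nsmul_eq_mul, card_univ] at h2
    apply hg₀
    refine mul_left_cancel₀ hcP.ne' ?_
    linarith
  let Φ : (PathVertex Γ m → ℝ) →ₗ[ℝ] (Γ ⧸ P) → ℝ :=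
    { toFun := fun u c => ∑ p : P, u (Sum.inl (c.out * p))
      map_add' := fun u v => by
        funext c
        simp [sum_add_distrib]
      map_smul' := fun r u => by
        funext c
        simp [mul_sum] }
  -- The translate indexed by y has coset sum ψ(y⁻¹c) at c, which is ψ 1 exactly when c = y and ψ t
  -- otherwise.
  have h1 := card_le_card_add_one_of_mem_span Φ T hab
    (fun y => fun z => F (Sum.map (y.out⁻¹ * ·) (Prod.map (y.out⁻¹ * ·) id) z))
    (fun y => hspan _ (eigenvector_translate hS htS ht1 (by omega) hFeig _))
    (fun y c => by
      have h2 : (y.out⁻¹ * c.out ∈ P) ↔ c = y := by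
        rw [← QuotientGroup.eq, QuotientGroup.out_eq', QuotientGroup.out_eq', eq_comm]
      have h3 := hψval (y.out⁻¹ * c.out)
      simp only [h2] at h3
      rw [← h3]
      simp [Φ, hψ, mul_assoc])
  rw [Nat.card_eq_fintype_card]
  omega

end Multiplicity

end Preliminaries

theorem theorem3p2 {Γ : Type*} [Group Γ] [Fintype Γ]
    (S : Finset Γ) (hS : ∀ s ∈ S, s⁻¹ ∈ S) (hS2 : 2 ≤ S.card)
    (P : Subgroup Γ) [Fintype P] (hP : P = Subgroup.closure (S : Set Γ))
    (hdc : Nat.card (DoubleCoset.Quotient (P : Set Γ) (P : Set Γ)) = 2)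
    (t : Γ) (htP : t ∉ P) (ht : t ≠ t⁻¹)
    (κ : ℝ) (hκ : (cayleyGraph ((fun p : P => (p : Γ)) ⁻¹' (S : Set Γ))).spectralGap = κ)
    (m : ℕ) (hm : 4 ≤ m) (hSm : 4 / κ ≤ (S.card : ℝ) ^ (m - 1)) :
    (pathReplacedCayleyGraph (S : Set Γ) t m).Connected ∧
    Fintype.card (PathVertex Γ m) = Fintype.card Γ * m ∧
    IsGreatest (Set.range (pathReplacedCayleyGraph (S : Set Γ) t m).degree) (S.card + 2) ∧
    (Fintype.card Γ : ℝ) / (Fintype.card P : ℝ) - 1 ≤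
      ((pathReplacedCayleyGraph (S : Set Γ) t m).secondEigenvalueMultiplicity : ℝ) := by
  have hSP : ∀ s ∈ S, s ∈ P := fun s hs => hP ▸ Subgroup.subset_closure hs
  refine ⟨pathReplacedCayleyGraph_connected hS (by omega) hP hdc htP, card_pathVertex (by omega),
    isGreatest_degree_pathReplacedCayleyGraph hS (fun h => htP (hSP t h))
      (fun h => htP (h ▸ P.one_mem)) (by omega), ?_⟩
  have h1 := card_quotient_le_secondEigenvalueMultiplicity_add_one hS hS2 hP htP hm hdc
    (by rwa [hκ])
  have h2 := P.card_eq_card_quotient_mul_card_subgroup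
  rw [Nat.card_eq_fintype_card, Nat.card_eq_fintype_card (α := P)] at h2
  have hcP : (0 : ℝ) < Fintype.card P := by exact_mod_cast Fintype.card_pos
  rw [h2, Nat.cast_mul, mul_div_cancel_right₀ _ hcP.ne', sub_le_iff_le_add]
  exact_mod_cast h1
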